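/- Let $n,p\ge 0$, $M\ge 2$, $\Omega=\{1,\dots,M\}$, $A_i\in\mathbb R^{n\times n}$ ($i\in\Omega$) and $C\in\mathbb R^{p\times n}$, and consider the switched linear system $\dot x(t)=A_{\sigma(t)}x(t)$, $x(t_0)=x_0$, with output $z(t)=Cx(t)$ and switching signal $\sigma(t)\in\Omega$. Suppose that there are symmetric positive definite matrices $X_i\in\mathbb R^{n\times n}$ ($i\in\Omega$) and a number $\gamma>0$ such that $$A_i'X_i+X_iA_i+\gamma(X_j-X_i)+C'C<0\qquad\text{for all } i,j\in\Omega,\ j\ne i .$$ Let the system be governed by the min-switching law $$\sigma(t)\in\operatorname*{argmin}_{j\in\Omega}\,x(t)'X_jx(t).$$ Here a trajectory on $[t_0,t_1]$ is a function $x$ that either is a Carathéodory solution of $\dot x=A_{\sigma(t)}x$ for some measurable $\sigma$ that obeys the law for almost every $t\in[t_0,t_1]$, or (sliding motions) is a uniform limit on $[t_0,t_1]$ of solutions under sample-and-hold implementations of the law, in which the mode is chosen as a minimizer at each sampling instant and held until the next one, with the maximal sampling interval tending to $0$. Then the origin is globally exponentially stable: from every initial condition $(t_0,x_0)$ a trajectory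 exists on $[t_0,\infty)$ (that is, a function that is a trajectory on $[t_0,t_1]$ for every $t_1\ge t_0$), and there are constants $K,\alpha>0$, independent of $t_0$, $t_1$, $x_0$ and the trajectory, such that every trajectory on an interval $[t_0,t_1]$ satisfies $$\|x(t)\|\le K e^{-\alpha(t-t_0)}\|x(t_0)\|\qquad(t_0\le t\le t_1).$$ Furthermore, along every such trajectory, $$J(x_0,t)=\int_{t_0}^{t}z(\tau)'z(\tau)\,d\tau\le\sum_{i\in\Omega}x_0'X_ix_0,\qquad x_0=x(t_0),\quad t_0\le t\le t_1 .$$ -/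

import Mathlib

open MeasureTheory Set
open scoped Matrix

/-- The quadratic form `x' X x`. -/
def quadForm {n : ℕ} (X : Matrix (Fin n) (Fin n) ℝ) (x : Fin n → ℝ) : ℝ :=
  x ⬝ᵥ (X *ᵥ x)

/-- `i ∈ argmin_j x' X_j x`, the minimum being over all modes. -/
def IsMinMode {n M : ℕ} (X : Fin M → Matrix (Fin n) (Fin n) ℝ) (x : Fin n → ℝ)
    (i : Fin M) : Prop :=
  ∀ j, quadForm (X i) x ≤ quadForm (X j) x

/-- `x` solves the switched linear system `ẋ = A_{σ(t)} x` on `[t₀, t₁]` for the (measurable)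
switching signal `σ`, in the sense of Carathéodory, that is, `x` satisfies the integral equation.
(As `x` is continuous and `σ` is measurable with finitely many values, the integrand is bounded
and measurable.) -/
def IsSwitchedSolution {n M : ℕ} (A : Fin M → Matrix (Fin n) (Fin n) ℝ) (t₀ t₁ : ℝ)
    (σ : ℝ → Fin M) (x : ℝ → Fin n → ℝ) : Prop :=
  Measurable σ ∧ ContinuousOn x (Icc t₀ t₁) ∧
    ∀ t ∈ Icc t₀ t₁, x t = x t₀ + ∫ s in t₀..t, A (σ s) *ᵥ x s

/-- The exact min-switching law `σ(t) ∈ argmin_j x(t)' X_j x(t)`, for almost every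
`t ∈ [t₀, t₁]`. -/
def FollowsMinLaw {n M : ℕ} (X : Fin M → Matrix (Fin n) (Fin n) ℝ) (t₀ t₁ : ℝ)
    (σ : ℝ → Fin M) (x : ℝ → Fin n → ℝ) : Prop :=
  ∀ᵐ t, t ∈ Icc t₀ t₁ → IsMinMode X (x t) (σ t)

/-- Sample-and-hold implementation of the min-switching law on `[t₀, t₁]`: there are sampling
instants `t₀ = τ 0 < τ 1 < ⋯`, at distance at most `h`, such that the mode held on
`[τ k, τ (k + 1))` minimizes `x' X_j x` at the state `x (τ k)`. -/
def FollowsSampledMinLaw {n M : ℕ} (X : Fin M → Matrix (Fin n) (Fin n) ℝ) (h t₀ t₁ : ℝ)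
    (σ : ℝ → Fin M) (x : ℝ → Fin n → ℝ) : Prop :=
  ∃ τ : ℕ → ℝ, StrictMono τ ∧ τ 0 = t₀ ∧ (∀ k, τ (k + 1) ≤ τ k + h) ∧ (∃ N, t₁ ≤ τ N) ∧
    ∀ k, τ k ≤ t₁ → IsMinMode X (x (τ k)) (σ (τ k)) ∧
      ∀ t ∈ Ico (τ k) (τ (k + 1)), σ t = σ (τ k)

/-- Trajectories on `[t₀, t₁]` of the switched linear system under the min-switching law: either a
solution for a switching signal that obeys the law exactly, or (as the law may call for infinitely
fast switching, in which case no exact solution exists: sliding motions) a uniform limit of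
solutions under sample-and-hold implementations of the law with sampling intervals tending
to zero. -/
def IsMinSwitchingTrajectory {n M : ℕ} (A X : Fin M → Matrix (Fin n) (Fin n) ℝ) (t₀ t₁ : ℝ)
    (x : ℝ → Fin n → ℝ) : Prop :=
  (∃ σ : ℝ → Fin M, IsSwitchedSolution A t₀ t₁ σ x ∧ FollowsMinLaw X t₀ t₁ σ x) ∨
  (∀ ε : ℝ, 0 < ε → ∃ (σ : ℝ → Fin M) (y : ℝ → Fin n → ℝ),
    IsSwitchedSolution A t₀ t₁ σ y ∧ FollowsSampledMinLaw X ε t₀ t₁ σ y ∧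
      ∀ t ∈ Icc t₀ t₁, ‖x t - y t‖ ≤ ε)

/-- Global exponential stability of the origin for a family of trajectories
(`S t₀ t₁ x`: `x` is a trajectory on `[t₀, t₁]`), with constants that are uniform in the initial
time, the initial state, the trajectory and the length of its interval. The norm is the Euclidean
one. -/
def GloballyExponentiallyStable {n : ℕ} (S : ℝ → ℝ → (ℝ → Fin n → ℝ) → Prop) : Prop :=
  ∃ K α : ℝ, 0 < K ∧ 0 < α ∧ ∀ (t₀ t₁ : ℝ) (x : ℝ → Fin n → ℝ), S t₀ t₁ x →
    ∀ t ∈ Icc t₀ t₁,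
      ‖WithLp.toLp 2 (x t)‖ ≤ K * Real.exp (-α * (t - t₀)) * ‖WithLp.toLp 2 (x t₀)‖

/-- The performance index `∫_{t₀}^t z(s)' z(s) ds` with `z = C x`. -/
noncomputable def performanceIndex {n p : ℕ} (C : Matrix (Fin p) (Fin n) ℝ)
    (x : ℝ → Fin n → ℝ) (t₀ t : ℝ) : ℝ :=
  ∫ s in t₀..t, (C *ᵥ x s) ⬝ᵥ (C *ᵥ x s)

/-! Write V_i(x) = x'X_i x and V = min_i V_i. While mode i is minimizing, V_j - V_i ≥ 0, so the
matrix inequality for a single j ≠ i makes V_i' + |Cx|² at most -ε|x|² along mode i. Half of this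
margin survives if i minimizes only at a state within relative distance δ, and it pays for a decay
rate α (`exists_decay_rate`). Integration gives e^{α(t-t₀)} μ|x(t)|² + J ≤ V_j(x₀) for every j,
which contains both the stability and the cost bound (`exists_energy_estimate`).

Along an exact solution V is Lipschitz in time and touches the active V_i from below, so almost
everywhere it has the same derivative. Along a sampled solution the form of the held mode is used:
the state moves relatively little between samples, and resampling can only lower the energy. Sliding
motions inherit the estimate in the limit.

The same estimate bounds the sampled solutions uniformly, hence makes them equi-Lipschitz, and
Arzelà–Ascoli yields a trajectory on the whole half-line (`exists_minSwitchingTrajectory`). -/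

/-! ### Bounds for matrices and quadratic forms -/

theorem abs_dotProduct_le {n : ℕ} (x y : Fin n → ℝ) : |x ⬝ᵥ y| ≤ n * ‖x‖ * ‖y‖ := by
  calc |x ⬝ᵥ y| ≤ ∑ i, |x i * y i| := Finset.abs_sum_le_sum_abs _ _
    _ ≤ ∑ _i : Fin n, ‖x‖ * ‖y‖ := by
      refine Finset.sum_le_sum fun i _ => ?_
      rw [abs_mul]
      exact mul_le_mul (norm_le_pi_norm x i) (norm_le_pi_norm y i) (abs_nonneg _) (norm_nonneg _)
    _ = n * ‖x‖ * ‖y‖ := by simp [mul_assoc]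

theorem exists_norm_mulVec_le {m n : ℕ} (B : Matrix (Fin m) (Fin n) ℝ) :
    ∃ c, 0 ≤ c ∧ ∀ x, ‖B *ᵥ x‖ ≤ c * ‖x‖ :=
  ⟨_, norm_nonneg (Matrix.mulVecLin B).toContinuousLinearMap, fun x =>
    (Matrix.mulVecLin B).toContinuousLinearMap.le_opNorm x⟩

theorem exists_norm_mulVec_le_of_family {M n : ℕ} (A : Fin M → Matrix (Fin n) (Fin n) ℝ) :
    ∃ c, 0 ≤ c ∧ ∀ i x, ‖A i *ᵥ x‖ ≤ c * ‖x‖ := by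
  choose c hc h using fun i => exists_norm_mulVec_le (A i)
  refine ⟨∑ i, c i, Finset.sum_nonneg fun i _ => hc i, fun i x => (h i x).trans ?_⟩
  gcongr
  exact Finset.single_le_sum (fun i _ => hc i) (Finset.mem_univ i)

theorem exists_abs_dotProduct_mulVec_le {n : ℕ} (B : Matrix (Fin n) (Fin n) ℝ) :
    ∃ c, 0 ≤ c ∧ ∀ x y, |x ⬝ᵥ (B *ᵥ y)| ≤ c * ‖x‖ * ‖y‖ := by
  obtain ⟨c, hc, h⟩ := exists_norm_mulVec_le B
  refine ⟨n * c, by positivity, fun x y => (abs_dotProduct_le _ _).trans ?_⟩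
  calc (n : ℝ) * ‖x‖ * ‖B *ᵥ y‖ ≤ n * ‖x‖ * (c * ‖y‖) := by gcongr; exact h y
    _ = _ := by ring

theorem continuous_quadForm {n : ℕ} (X : Matrix (Fin n) (Fin n) ℝ) :
    Continuous (quadForm X) := by
  unfold quadForm
  fun_prop

theorem quadForm_smul {n : ℕ} (X : Matrix (Fin n) (Fin n) ℝ) (a : ℝ) (x : Fin n → ℝ) :
    quadForm X (a • x) = a ^ 2 * quadForm X x := by
  simp only [quadForm, Matrix.mulVec_smul, dotProduct_smul, smul_dotProduct, smul_eq_mul]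
  ring

theorem exists_quadForm_le {n : ℕ} (B : Matrix (Fin n) (Fin n) ℝ) :
    ∃ c, 0 ≤ c ∧ ∀ x, quadForm B x ≤ c * ‖x‖ ^ 2 := by
  obtain ⟨c, hc, h⟩ := exists_abs_dotProduct_mulVec_le B
  exact ⟨c, hc, fun x => (le_abs_self _).trans ((h x x).trans_eq (by ring))⟩

theorem exists_abs_quadForm_sub_le {n : ℕ} (B : Matrix (Fin n) (Fin n) ℝ) :
    ∃ c, 0 ≤ c ∧ ∀ x y, |quadForm B x - quadForm B y| ≤ c * (‖x‖ + ‖y‖) * ‖x - y‖ := by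
  obtain ⟨c, hc, h⟩ := exists_abs_dotProduct_mulVec_le B
  refine ⟨c, hc, fun x y => ?_⟩
  have e : quadForm B x - quadForm B y = (x - y) ⬝ᵥ (B *ᵥ x) + y ⬝ᵥ (B *ᵥ (x - y)) := by
    simp only [quadForm, sub_dotProduct, Matrix.mulVec_sub, dotProduct_sub]
    ring
  rw [e]
  refine (abs_add_le _ _).trans ((add_le_add (h _ _) (h _ _)).trans_eq (by ring))

theorem Matrix.PosDef.quadForm_pos {n : ℕ} {P : Matrix (Fin n) (Fin n) ℝ} (hP : P.PosDef)
    {x : Fin n → ℝ} (hx : x ≠ 0) : 0 < quadForm P x := by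
  simpa [quadForm] using hP.dotProduct_mulVec_pos hx

theorem Matrix.PosDef.quadForm_nonneg {n : ℕ} {P : Matrix (Fin n) (Fin n) ℝ} (hP : P.PosDef)
    (x : Fin n → ℝ) : 0 ≤ quadForm P x := by
  simpa [quadForm] using hP.posSemidef.dotProduct_mulVec_nonneg x

/-- By compactness the form attains a positive minimum on the unit sphere; homogeneity does the
rest. The sphere is empty when n = 0. -/
theorem Matrix.PosDef.exists_pos_mul_norm_sq_le {n : ℕ} {P : Matrix (Fin n) (Fin n) ℝ}
    (hP : P.PosDef) : ∃ ε, 0 < ε ∧ ∀ x, ε * ‖x‖ ^ 2 ≤ quadForm P x := by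
  obtain hS | hS := (Metric.sphere (0 : Fin n → ℝ) 1).eq_empty_or_nonempty
  · refine ⟨1, one_pos, fun x => ?_⟩
    have hx : x = 0 := by
      by_contra hx
      have : ‖x‖⁻¹ • x ∈ Metric.sphere (0 : Fin n → ℝ) 1 := by
        simp [norm_smul, norm_ne_zero_iff.2 hx]
      simp [hS] at this
    simp [hx, quadForm]
  · obtain ⟨z, hz, hmin⟩ := (isCompact_sphere (0 : Fin n → ℝ) 1).exists_isMinOn hS
      (continuous_quadForm P).continuousOn
    have hz0 : z ≠ 0 := by
      rintro rfl
      simp at hz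
    refine ⟨quadForm P z, hP.quadForm_pos hz0, fun x => ?_⟩
    by_cases hx : x = 0
    · simp [hx, quadForm]
    have hm : ‖x‖⁻¹ • x ∈ Metric.sphere (0 : Fin n → ℝ) 1 := by
      simp [norm_smul, norm_ne_zero_iff.2 hx]
    have h := isMinOn_iff.1 hmin _ hm
    rw [quadForm_smul] at h
    have hp : 0 < ‖x‖ := norm_pos_iff.2 hx
    calc quadForm P z * ‖x‖ ^ 2 ≤ (‖x‖⁻¹ ^ 2 * quadForm P x) * ‖x‖ ^ 2 := by gcongr
      _ = quadForm P x := by field_simp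

theorem exists_pos_mul_norm_sq_le_of_family {M n : ℕ} {X : Fin M → Matrix (Fin n) (Fin n) ℝ}
    (hX : ∀ i, (X i).PosDef) : ∃ ε, 0 < ε ∧ ∀ i x, ε * ‖x‖ ^ 2 ≤ quadForm (X i) x := by
  choose ε hε h using fun i => (hX i).exists_pos_mul_norm_sq_le
  obtain hM | hM := isEmpty_or_nonempty (Fin M)
  · exact ⟨1, one_pos, fun i => hM.elim i⟩
  obtain ⟨k, hk⟩ := Finite.exists_min ε
  refine ⟨ε k, hε k, fun i x => le_trans ?_ (h i x)⟩
  gcongr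
  exact hk i

/-! ### The Lyapunov inequality for a single mode -/

/-- The derivative of `x' X x` along `v`. -/
def quadFormDeriv {n : ℕ} (X : Matrix (Fin n) (Fin n) ℝ) (x v : Fin n → ℝ) : ℝ :=
  v ⬝ᵥ (X *ᵥ x) + x ⬝ᵥ (X *ᵥ v)

theorem HasDerivAt.quadForm {n : ℕ} (X : Matrix (Fin n) (Fin n) ℝ) {x : ℝ → Fin n → ℝ}
    {v : Fin n → ℝ} {t : ℝ} (h : HasDerivAt x v t) :
    HasDerivAt (fun s => quadForm X (x s)) (quadFormDeriv X (x t) v) t := by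
  rw [hasDerivAt_pi] at h
  have h2 : ∀ i, HasDerivAt (fun s => (X *ᵥ x s) i) ((X *ᵥ v) i) t := fun i =>
    HasDerivAt.fun_sum (u := Finset.univ) fun j _ => (h j).const_mul (X i j)
  have := HasDerivAt.fun_sum (u := Finset.univ) fun i _ => (h i).fun_mul (h2 i)
  simpa +instances only [quadFormDeriv, _root_.quadForm, dotProduct, ← Finset.sum_add_distrib] using this

theorem quadForm_lmi {n p : ℕ} (A X Y : Matrix (Fin n) (Fin n) ℝ) (C : Matrix (Fin p) (Fin n) ℝ)
    (γ : ℝ) (x : Fin n → ℝ) :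
    quadForm (-(Aᵀ * X + X * A + γ • (Y - X) + Cᵀ * C)) x =
      -(quadFormDeriv X x (A *ᵥ x) + γ * (quadForm Y x - quadForm X x) +
        (C *ᵥ x) ⬝ᵥ (C *ᵥ x)) := by
  simp only [quadForm, quadFormDeriv, Matrix.neg_mulVec, Matrix.add_mulVec, Matrix.sub_mulVec,
    Matrix.smul_mulVec, dotProduct_neg, dotProduct_add, dotProduct_sub, dotProduct_smul,
    ← Matrix.mulVec_mulVec, smul_eq_mul, Matrix.mulVec_transpose]
  simp only [← Matrix.dotProduct_mulVec, dotProduct_comm x (_ ᵥ* _)]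
  rw [dotProduct_comm (X *ᵥ x)]

/-- The Lyapunov inequality along the mode `i`, which persists as long as the state `y` is
close to a state `w` at which `i` is a minimizing mode. -/
theorem exists_decay_rate {n p M : ℕ} (hM : 2 ≤ M)
    (A : Fin M → Matrix (Fin n) (Fin n) ℝ) (C : Matrix (Fin p) (Fin n) ℝ)
    (X : Fin M → Matrix (Fin n) (Fin n) ℝ) (hX : ∀ i, (X i).PosDef) (γ : ℝ) (hγ : 0 < γ)
    (hLM : ∀ i j, j ≠ i →
      (-((A i)ᵀ * X i + X i * A i + γ • (X j - X i) + Cᵀ * C)).PosDef) :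
    ∃ α δ, 0 < α ∧ 0 < δ ∧ ∀ i y w, IsMinMode X w i → ‖y - w‖ ≤ δ * ‖y‖ →
      α * quadForm (X i) y + quadFormDeriv (X i) y (A i *ᵥ y) + (C *ᵥ y) ⬝ᵥ (C *ᵥ y) ≤ 0 := by
  have : ∀ i, ∃ α δ, 0 < α ∧ 0 < δ ∧ ∀ y w, IsMinMode X w i → ‖y - w‖ ≤ δ * ‖y‖ →
      α * quadForm (X i) y + quadFormDeriv (X i) y (A i *ᵥ y) + (C *ᵥ y) ⬝ᵥ (C *ᵥ y) ≤ 0 := by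
    intro i
    have : Nontrivial (Fin M) := Fin.nontrivial_iff_two_le.2 hM
    obtain ⟨j, hj⟩ := exists_ne i
    obtain ⟨ε, hε, h⟩ := (hLM i j hj).exists_pos_mul_norm_sq_le
    obtain ⟨b, hb, hb'⟩ := exists_quadForm_le (X i)
    obtain ⟨c, hc, hc'⟩ := exists_abs_quadForm_sub_le (X j)
    obtain ⟨d, hd, hd'⟩ := exists_abs_quadForm_sub_le (X i)
    -- Since δ ≤ 1 gives ‖w‖ ≤ 2‖y‖, passing from w to y changes V_j - V_i by at most 3δ(c + d)‖y‖².
    -- This may cost half of the margin ε; the other half pays for α V_i, with α = (ε/2)/(b + 1).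
    obtain ⟨δ, hδ, hδ1, hδ2⟩ : ∃ δ : ℝ, 0 < δ ∧ δ ≤ 1 ∧ γ * (c + d) * 3 * δ ≤ ε / 2 := by
      have hK : 0 < γ * (c + d) * 3 + 1 := by positivity
      refine ⟨min 1 (ε / 2 / (γ * (c + d) * 3 + 1)), by positivity, min_le_left _ _, ?_⟩
      calc _ ≤ (γ * (c + d) * 3 + 1) * (ε / 2 / (γ * (c + d) * 3 + 1)) := by
            gcongr
            · linarith
            · exact min_le_right _ _
        _ = ε / 2 := by field_simp
    refine ⟨ε / 2 / (b + 1), δ, by positivity, hδ, fun y w hw hyw => ?_⟩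
    have h1 := h y
    rw [quadForm_lmi] at h1
    have h2 : ε / 2 / (b + 1) * quadForm (X i) y ≤ ε / 2 * ‖y‖ ^ 2 := by
      calc _ ≤ ε / 2 / (b + 1) * ((b + 1) * ‖y‖ ^ 2) := by
            gcongr
            exact (hb' y).trans (by gcongr; linarith)
        _ = _ := by field_simp
    have hw1 : ‖w‖ ≤ 2 * ‖y‖ := by
      have := norm_sub_norm_le w y
      rw [norm_sub_rev] at this
      nlinarith [norm_nonneg y]
    have hs : (‖y‖ + ‖w‖) * ‖y - w‖ ≤ 3 * δ * ‖y‖ ^ 2 := by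
      calc _ ≤ (‖y‖ + 2 * ‖y‖) * (δ * ‖y‖) := by gcongr
        _ = _ := by ring
    have h3 := hw j
    have h4 : -(c * (3 * δ * ‖y‖ ^ 2)) ≤ quadForm (X j) y - quadForm (X j) w := by
      refine (neg_le_neg ?_).trans (neg_le_of_abs_le (hc' y w))
      rw [mul_assoc]
      gcongr
    have h5 : quadForm (X i) y - quadForm (X i) w ≤ d * (3 * δ * ‖y‖ ^ 2) := by
      refine (le_of_abs_le (hd' y w)).trans ?_
      rw [mul_assoc]
      gcongr
    have h6 : -(ε / 2 * ‖y‖ ^ 2) ≤ γ * (quadForm (X j) y - quadForm (X i) y) := by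
      calc -(ε / 2 * ‖y‖ ^ 2) ≤ -(γ * (c + d) * 3 * δ * ‖y‖ ^ 2) := by gcongr
        _ = γ * (-((c + d) * (3 * δ * ‖y‖ ^ 2))) := by ring
        _ ≤ _ := by gcongr; linarith
    linarith
  choose α δ hα hδ h using this
  have : Nonempty (Fin M) := ⟨⟨0, by omega⟩⟩
  obtain ⟨k, hk⟩ := Finite.exists_min δ
  obtain ⟨l, hl⟩ := Finite.exists_min α
  refine ⟨α l, δ k, hα l, hδ k, fun i y w hw hyw => le_trans ?_
    (h i y w hw (hyw.trans (mul_le_mul_of_nonneg_right (hk i) (norm_nonneg y))))⟩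
  gcongr
  · exact (hX i).quadForm_nonneg y
  · exact hl i

/-! ### Integrating differential inequalities that hold almost everywhere -/

theorem AbsolutelyContinuousOnInterval.le_of_ae_hasDerivAt_nonpos {f : ℝ → ℝ} {a b : ℝ}
    (hab : a ≤ b) (hf : AbsolutelyContinuousOnInterval f a b)
    (h : ∀ᵐ t, t ∈ Icc a b → ∃ d ≤ 0, HasDerivAt f d t) : f b ≤ f a := by
  rw [← sub_nonpos, ← hf.integral_deriv_eq_sub, intervalIntegral.integral_of_le hab,
    ← integral_Icc_eq_integral_Ioc]
  refine setIntegral_nonpos_of_ae_restrict ?_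
  filter_upwards [ae_restrict_of_ae h, ae_restrict_mem measurableSet_Icc] with t ht htm
  obtain ⟨d, hd, hd'⟩ := ht htm
  rwa [hd'.deriv]

/-- The integrating factor is at least 1 and g ≥ 0, so the output term may stay unweighted. Keeping
t₀ apart from a lets the estimates on consecutive intervals be chained. -/
theorem exp_mul_add_integral_le {f g : ℝ → ℝ} {α t₀ a b : ℝ} (hα : 0 ≤ α) (ha : t₀ ≤ a)
    (hab : a ≤ b) (hf : AbsolutelyContinuousOnInterval f a b) (hg : ContinuousOn g (Icc t₀ b))
    (hg0 : ∀ t, 0 ≤ g t)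
    (h : ∀ᵐ t, t ∈ Icc a b → ∃ d, HasDerivAt f d t ∧ α * f t + d + g t ≤ 0) :
    Real.exp (α * (b - t₀)) * f b + ∫ s in t₀..b, g s ≤
      Real.exp (α * (a - t₀)) * f a + ∫ s in t₀..a, g s := by
  have hgi : IntervalIntegrable g volume t₀ b :=
    ContinuousOn.intervalIntegrable (by rwa [uIcc_of_le (ha.trans hab)])
  have hsub : uIcc a b ⊆ uIcc t₀ b := by
    rw [uIcc_of_le hab, uIcc_of_le (ha.trans hab)]
    exact Icc_subset_Icc_left ha
  have hexp : AbsolutelyContinuousOnInterval (fun t => Real.exp (α * (t - t₀))) a b :=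
    ContDiffOn.absolutelyContinuousOnInterval (by fun_prop)
  have hint : AbsolutelyContinuousOnInterval (fun t => ∫ s in t₀..t, g s) a b :=
    (hgi.absolutelyContinuousOnInterval_intervalIntegral left_mem_uIcc).mono hsub
  refine AbsolutelyContinuousOnInterval.le_of_ae_hasDerivAt_nonpos
    (f := fun t => Real.exp (α * (t - t₀)) * f t + ∫ s in t₀..t, g s) hab
    ((hexp.fun_mul hf).fun_add hint) ?_
  filter_upwards [h, hgi.ae_hasDerivAt_integral] with t ht ht' htm
  obtain ⟨d, hd, hle⟩ := ht htm
  have hge := ht' (hsub (by rwa [uIcc_of_le hab])) t₀ left_mem_uIcc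
  have he : HasDerivAt (fun t => Real.exp (α * (t - t₀))) (Real.exp (α * (t - t₀)) * α) t := by
    simpa using (((hasDerivAt_id t).sub_const t₀).const_mul α).exp
  refine ⟨_, ?_, (he.fun_mul hd).fun_add hge⟩
  have h1 : 1 ≤ Real.exp (α * (t - t₀)) :=
    Real.one_le_exp (mul_nonneg hα (by linarith [htm.1]))
  calc Real.exp (α * (t - t₀)) * α * f t + Real.exp (α * (t - t₀)) * d + g t
      ≤ Real.exp (α * (t - t₀)) * α * f t + Real.exp (α * (t - t₀)) * d +
        Real.exp (α * (t - t₀)) * g t := by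
        gcongr
        exact le_mul_of_one_le_left (hg0 t) h1
    _ = Real.exp (α * (t - t₀)) * (α * f t + d + g t) := by ring
    _ ≤ 0 := mul_nonpos_of_nonneg_of_nonpos (Real.exp_nonneg _) hle

/-! ### Regularity of switched solutions -/

section SwitchedSolution

variable {n M : ℕ} {A : Fin M → Matrix (Fin n) (Fin n) ℝ} {t₀ t₁ : ℝ} {σ : ℝ → Fin M}
  {x : ℝ → Fin n → ℝ}

theorem integrableOn_mulVec_of_continuousOn (hσ : Measurable σ)
    (hx : ContinuousOn x (Icc t₀ t₁)) :
    IntegrableOn (fun s => A (σ s) *ᵥ x s) (Icc t₀ t₁) := by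
  obtain ⟨L, hL, hA⟩ := exists_norm_mulVec_le_of_family A
  obtain ⟨R, hR⟩ := isCompact_Icc.exists_bound_of_continuousOn hx
  have hm : AEStronglyMeasurable (fun s => A (σ s) *ᵥ x s) (volume.restrict (Icc t₀ t₁)) := by
    have h1 : ∀ i, AEStronglyMeasurable (fun s => A i *ᵥ x s) (volume.restrict (Icc t₀ t₁)) :=
      fun i => ContinuousOn.aestronglyMeasurable
        ((Continuous.matrix_mulVec continuous_const continuous_id).comp_continuousOn hx)
        measurableSet_Icc
    -- Measurability comes from splitting the integrand over the finitely many level sets of σ.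
    have h2 : (fun s => A (σ s) *ᵥ x s) =
        fun s => ∑ i, (σ ⁻¹' {i}).indicator (fun s => A i *ᵥ x s) s := by
      funext s
      rw [Finset.sum_eq_single (σ s)]
      · simp
      · intro i _ hi
        simp [Set.indicator, hi.symm]
      · simp
    rw [h2]
    exact Finset.aestronglyMeasurable_fun_sum _ fun i _ =>
      (h1 i).indicator (hσ (measurableSet_singleton i))
  refine IntegrableOn.of_bound measure_Icc_lt_top hm (L * R) ?_
  filter_upwards [ae_restrict_mem measurableSet_Icc] with s hs
  exact (hA _ _).trans (by gcongr; exact hR s hs)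

theorem IsSwitchedSolution.intervalIntegrable (h : IsSwitchedSolution A t₀ t₁ σ x) {a b : ℝ}
    (ha : a ∈ Icc t₀ t₁) (hb : b ∈ Icc t₀ t₁) :
    IntervalIntegrable (fun s => A (σ s) *ᵥ x s) volume a b := by
  refine ((integrableOn_mulVec_of_continuousOn h.1 h.2.1).mono_set
    ?_).intervalIntegrable
  exact (convex_Icc t₀ t₁).ordConnected.uIcc_subset ha hb

theorem IsSwitchedSolution.sub_eq_integral (h : IsSwitchedSolution A t₀ t₁ σ x) {a b : ℝ}
    (ha : a ∈ Icc t₀ t₁) (hb : b ∈ Icc t₀ t₁) :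
    x b - x a = ∫ s in a..b, A (σ s) *ᵥ x s := by
  have h0 : t₀ ∈ Icc t₀ t₁ := ⟨le_rfl, ha.1.trans ha.2⟩
  rw [h.2.2 a ha, h.2.2 b hb, add_sub_add_left_eq_sub,
    intervalIntegral.integral_interval_sub_left (h.intervalIntegrable h0 hb)
      (h.intervalIntegrable h0 ha)]

theorem IsSwitchedSolution.norm_sub_le (h : IsSwitchedSolution A t₀ t₁ σ x) {L R a b : ℝ}
    (hL : 0 ≤ L) (hA : ∀ i y, ‖A i *ᵥ y‖ ≤ L * ‖y‖) (hab : a ≤ b)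
    (ha : a ∈ Icc t₀ t₁) (hb : b ∈ Icc t₀ t₁) (hR : ∀ t ∈ Icc a b, ‖x t‖ ≤ R) :
    ‖x b - x a‖ ≤ L * R * (b - a) := by
  rw [h.sub_eq_integral ha hb]
  refine (intervalIntegral.norm_integral_le_of_norm_le_const fun s hs => ?_).trans_eq
    (by rw [abs_of_nonneg (sub_nonneg.2 hab)])
  rw [uIoc_of_le hab] at hs
  exact (hA _ _).trans (by gcongr; exact hR s ⟨hs.1.le, hs.2⟩)

theorem IsSwitchedSolution.lipschitz (h : IsSwitchedSolution A t₀ t₁ σ x) {L R : ℝ}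
    (hL : 0 ≤ L) (hA : ∀ i y, ‖A i *ᵥ y‖ ≤ L * ‖y‖) (hR : ∀ t ∈ Icc t₀ t₁, ‖x t‖ ≤ R) :
    ∀ a ∈ Icc t₀ t₁, ∀ b ∈ Icc t₀ t₁, ‖x a - x b‖ ≤ L * R * |a - b| := by
  intro a ha b hb
  rcases le_total a b with hab | hab
  · rw [norm_sub_rev, abs_sub_comm, abs_of_nonneg (sub_nonneg.2 hab)]
    exact h.norm_sub_le hL hA hab ha hb fun t ht => hR t ⟨ha.1.trans ht.1, ht.2.trans hb.2⟩
  · rw [abs_of_nonneg (sub_nonneg.2 hab)]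
    exact h.norm_sub_le hL hA hab hb ha fun t ht => hR t ⟨hb.1.trans ht.1, ht.2.trans ha.2⟩

theorem IsSwitchedSolution.ae_hasDerivAt (h : IsSwitchedSolution A t₀ t₁ σ x) :
    ∀ᵐ t, t ∈ Icc t₀ t₁ → HasDerivAt x (A (σ t) *ᵥ x t) t := by
  rcases lt_or_ge t₁ t₀ with h01 | h01
  · simp [Icc_eq_empty_of_lt h01]
  have hi := h.intervalIntegrable ⟨le_rfl, h01⟩ ⟨h01, le_rfl⟩
  -- The integral equation says nothing outside the interval, so the endpoints are discarded to have
  -- two-sided derivatives.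
  have e0 : ∀ᵐ t : ℝ, t ≠ t₀ := by simp [ae_iff, measure_singleton]
  have e1 : ∀ᵐ t : ℝ, t ≠ t₁ := by simp [ae_iff, measure_singleton]
  filter_upwards [hi.ae_hasDerivAt_integral, e0, e1] with t ht h0 h1 htm
  have hd := ht (by rwa [uIcc_of_le h01]) t₀ left_mem_uIcc
  refine (hd.const_add (x t₀)).congr_of_eventuallyEq ?_
  filter_upwards [Icc_mem_nhds (lt_of_le_of_ne htm.1 h0.symm) (lt_of_le_of_ne htm.2 h1)]
    with s hs using h.2.2 s hs

theorem IsSwitchedSolution.exists_lipschitz_quadForm (h : IsSwitchedSolution A t₀ t₁ σ x)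
    (X : Matrix (Fin n) (Fin n) ℝ) :
    ∃ K : NNReal, LipschitzOnWith K (fun t => quadForm X (x t)) (Icc t₀ t₁) := by
  obtain ⟨L, hL, hA⟩ := exists_norm_mulVec_le_of_family A
  obtain ⟨R, hR⟩ := isCompact_Icc.exists_bound_of_continuousOn h.2.1
  obtain ⟨c, hc, hq⟩ := exists_abs_quadForm_sub_le X
  refine ⟨Real.toNNReal (c * (R + R) * (L * R)), LipschitzOnWith.of_dist_le_mul
    fun a ha b hb => ?_⟩
  have hR0 : 0 ≤ R := (norm_nonneg _).trans (hR a ha)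
  rw [Real.coe_toNNReal _ (by positivity), Real.dist_eq, Real.dist_eq, mul_assoc]
  refine (hq _ _).trans ?_
  gcongr
  · exact hR a ha
  · exact hR b hb
  · exact h.lipschitz hL hA hR a ha b hb

end SwitchedSolution

/-! ### Pointwise minima of Lipschitz functions -/

/-- A pointwise minimum of finitely many Lipschitz functions is Lipschitz. -/
theorem exists_lipschitz_min {M : ℕ} (hM : 0 < M) {f : Fin M → ℝ → ℝ} {s : Set ℝ}
    (hf : ∀ i, ∃ K : NNReal, LipschitzOnWith K (f i) s) :
    ∃ v : ℝ → ℝ, (∀ t i, v t ≤ f i t) ∧ (∀ t, ∃ i, v t = f i t) ∧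
      ∃ K : NNReal, LipschitzOnWith K v s := by
  have : Nonempty (Fin M) := ⟨⟨0, hM⟩⟩
  choose m hm using fun t => Finite.exists_min fun i => f i t
  choose K hK using hf
  refine ⟨fun t => f (m t) t, hm, fun t => ⟨_, rfl⟩, ∑ i, K i, ?_⟩
  refine LipschitzOnWith.of_le_add_mul _ fun a ha b hb => ?_
  have h1 := (hK (m b)).dist_le_mul a ha b hb
  rw [Real.dist_eq] at h1
  have h2 : ((K (m b) : NNReal) : ℝ) ≤ ((∑ i, K i : NNReal) : ℝ) :=
    NNReal.coe_le_coe.2 (Finset.single_le_sum (fun _ _ => zero_le) (Finset.mem_univ (m b)))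
  have h3 : (K (m b) : ℝ) * dist a b ≤ ((∑ i, K i : NNReal) : ℝ) * dist a b := by gcongr
  linarith [hm a (m b), le_of_abs_le h1]

/-- Where it is differentiable, a lower bound of `f` has the derivative of `f` at a point of
contact. -/
theorem hasDerivAt_of_le_of_eq {v f : ℝ → ℝ} {t d : ℝ} (hv : DifferentiableAt ℝ v t)
    (hf : HasDerivAt f d t) (hle : ∀ s, v s ≤ f s) (heq : v t = f t) : HasDerivAt v d t := by
  have hmin : IsLocalMin (fun s => f s - v s) t :=
    Filter.Eventually.of_forall fun s => by simpa [heq] using hle s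
  have := hmin.hasDerivAt_eq_zero (hf.sub hv.hasDerivAt)
  rw [sub_eq_zero.1 this]
  exact hv.hasDerivAt

/-! ### Energy estimates for exact and sampled switching -/

section EnergyEstimate

variable {n p M : ℕ} {A : Fin M → Matrix (Fin n) (Fin n) ℝ} {C : Matrix (Fin p) (Fin n) ℝ}
  {X : Fin M → Matrix (Fin n) (Fin n) ℝ} {α δ t₀ t₁ : ℝ} {σ : ℝ → Fin M} {x : ℝ → Fin n → ℝ}

theorem continuous_output_sq : Continuous fun x : Fin n → ℝ => (C *ᵥ x) ⬝ᵥ (C *ᵥ x) := by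
  fun_prop

theorem dotProduct_self_nonneg_real (z : Fin p → ℝ) : 0 ≤ z ⬝ᵥ z :=
  Finset.sum_nonneg fun i _ => mul_self_nonneg (z i)

/-- The energy estimate along an exact solution of the min-switching law. -/
theorem IsSwitchedSolution.energy_le_of_followsMinLaw (hM : 0 < M) (hα : 0 ≤ α)
    (hdecay : ∀ i y, IsMinMode X y i →
      α * quadForm (X i) y + quadFormDeriv (X i) y (A i *ᵥ y) + (C *ᵥ y) ⬝ᵥ (C *ᵥ y) ≤ 0)
    (h : IsSwitchedSolution A t₀ t₁ σ x) (hlaw : FollowsMinLaw X t₀ t₁ σ x)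
    {t : ℝ} (ht : t ∈ Icc t₀ t₁) :
    ∃ i, ∀ j, Real.exp (α * (t - t₀)) * quadForm (X i) (x t) + performanceIndex C x t₀ t ≤
      quadForm (X j) (x t₀) := by
  obtain ⟨v, hle, heq, K, hK⟩ := exists_lipschitz_min hM
    fun i => h.exists_lipschitz_quadForm (X i)
  have hsub : Icc t₀ t ⊆ Icc t₀ t₁ := Icc_subset_Icc_right ht.2
  have hac : AbsolutelyContinuousOnInterval v t₀ t :=
    LipschitzOnWith.absolutelyContinuousOnInterval (K := K)
      (by rw [uIcc_of_le ht.1]; exact hK.mono hsub)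
  have key := exp_mul_add_integral_le (f := v) (g := fun s => (C *ᵥ x s) ⬝ᵥ (C *ᵥ x s)) hα
    le_rfl ht.1 hac (continuous_output_sq.comp_continuousOn (h.2.1.mono hsub))
    (fun _ => dotProduct_self_nonneg_real _) (by
      filter_upwards [hac.ae_differentiableAt, h.ae_hasDerivAt, hlaw] with s h1 h2 h3 hs
      -- With the index frozen at σ s, the form lies above v and meets it at time s, so both have
      -- the same derivative there.
      have hv : v s = quadForm (X (σ s)) (x s) := by
        obtain ⟨i, hi⟩ := heq s
        exact le_antisymm (hle s _) ((h3 (hsub hs) i).trans_eq hi.symm)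
      refine ⟨_, hasDerivAt_of_le_of_eq (h1 (by rwa [uIcc_of_le ht.1]))
        ((h2 (hsub hs)).quadForm (X (σ s))) (fun r => hle r _) hv, ?_⟩
      rw [hv]
      exact hdecay _ _ (h3 (hsub hs)))
  obtain ⟨i, hi⟩ := heq t
  refine ⟨i, fun j => ?_⟩
  rw [← hi]
  refine key.trans ?_
  simpa using hle t₀ j

/-- Used on one holding interval, where the held mode may cease to be minimizing, so its own form
replaces the minimum. The mode may change at b, a null set. -/
theorem IsSwitchedSolution.energy_le_of_eqOn (hα : 0 ≤ α)
    (h : IsSwitchedSolution A t₀ t₁ σ x) {i : Fin M} {a b : ℝ} (ha : t₀ ≤ a) (hab : a ≤ b)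
    (hb : b ≤ t₁) (hσ : ∀ t ∈ Ico a b, σ t = i)
    (hdecay : ∀ t ∈ Icc a b, α * quadForm (X i) (x t) + quadFormDeriv (X i) (x t) (A i *ᵥ x t) +
      (C *ᵥ x t) ⬝ᵥ (C *ᵥ x t) ≤ 0) :
    Real.exp (α * (b - t₀)) * quadForm (X i) (x b) + performanceIndex C x t₀ b ≤
      Real.exp (α * (a - t₀)) * quadForm (X i) (x a) + performanceIndex C x t₀ a := by
  have hsub : Icc a b ⊆ Icc t₀ t₁ := Icc_subset_Icc ha hb
  obtain ⟨K, hK⟩ := h.exists_lipschitz_quadForm (X i)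
  have e1 : ∀ᵐ t : ℝ, t ≠ b := by simp [ae_iff, measure_singleton]
  refine exp_mul_add_integral_le (f := fun t => quadForm (X i) (x t))
    (g := fun s => (C *ᵥ x s) ⬝ᵥ (C *ᵥ x s)) hα ha hab
    (LipschitzOnWith.absolutelyContinuousOnInterval (K := K)
      (by rw [uIcc_of_le hab]; exact hK.mono hsub))
    (continuous_output_sq.comp_continuousOn (h.2.1.mono (Icc_subset_Icc_right hb)))
    (fun _ => dotProduct_self_nonneg_real _) ?_
  filter_upwards [h.ae_hasDerivAt, e1] with s h2 hne hs
  refine ⟨_, (h2 (hsub hs)).quadForm (X i), ?_⟩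
  rw [hσ s ⟨hs.1, lt_of_le_of_ne hs.2 hne⟩]
  exact hdecay s hs

/-- Along a solution, the relative change of the state over a short interval is small. -/
theorem IsSwitchedSolution.norm_sub_le_mul_norm (h : IsSwitchedSolution A t₀ t₁ σ x) {L η a b : ℝ}
    (hL : 0 ≤ L) (hA : ∀ i y, ‖A i *ᵥ y‖ ≤ L * ‖y‖) (ha : t₀ ≤ a) (hab : a ≤ b) (hb : b ≤ t₁)
    (hη : b - a ≤ η) (hLη : L * η ≤ 1 / 2) :
    ‖x b - x a‖ ≤ 2 * L * η * ‖x b‖ := by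
  have hsub : Icc a b ⊆ Icc t₀ t₁ := Icc_subset_Icc ha hb
  -- The change is first bounded by the largest norm on the interval; since L η ≤ 1/2, that norm is
  -- at most twice the final one.
  obtain ⟨s, hs, hmax⟩ := isCompact_Icc.exists_isMaxOn (nonempty_Icc.2 hab)
    (continuous_norm.comp_continuousOn (h.2.1.mono hsub))
  have hmax' : ∀ t ∈ Icc a b, ‖x t‖ ≤ ‖x s‖ := isMaxOn_iff.1 hmax
  have h1 : ‖x b - x s‖ ≤ L * ‖x s‖ * (b - s) :=
    h.norm_sub_le hL hA hs.2 (hsub hs) (hsub ⟨hab, le_rfl⟩) fun t ht =>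
      hmax' t ⟨hs.1.trans ht.1, ht.2⟩
  have h2 : ‖x b - x a‖ ≤ L * ‖x s‖ * (b - a) :=
    h.norm_sub_le hL hA hab (hsub ⟨le_rfl, hab⟩) (hsub ⟨hab, le_rfl⟩) hmax'
  have h3 : ‖x s‖ - ‖x b‖ ≤ ‖x b - x s‖ := by
    rw [norm_sub_rev]
    exact norm_sub_norm_le _ _
  have h4 : L * ‖x s‖ * (b - s) ≤ 1 / 2 * ‖x s‖ := by
    calc L * ‖x s‖ * (b - s) ≤ L * ‖x s‖ * η := by gcongr; linarith [hs.1]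
      _ = L * η * ‖x s‖ := by ring
      _ ≤ _ := by gcongr
  have h5 : ‖x s‖ ≤ 2 * ‖x b‖ := by linarith
  have hη0 : 0 ≤ η := by linarith
  calc ‖x b - x a‖ ≤ L * ‖x s‖ * (b - a) := h2
    _ ≤ L * (2 * ‖x b‖) * η := by gcongr
    _ = _ := by ring

/-- The energy estimate along a solution under a sufficiently fast sample-and-hold
implementation of the min-switching law. -/
theorem IsSwitchedSolution.energy_le_of_followsSampledMinLaw {L η : ℝ} (hα : 0 ≤ α)
    (hL : 0 ≤ L) (hA : ∀ i y, ‖A i *ᵥ y‖ ≤ L * ‖y‖) (hLη : L * η ≤ 1 / 2)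
    (hηδ : 2 * L * η ≤ δ)
    (hdecay : ∀ i y w, IsMinMode X w i → ‖y - w‖ ≤ δ * ‖y‖ →
      α * quadForm (X i) y + quadFormDeriv (X i) y (A i *ᵥ y) + (C *ᵥ y) ⬝ᵥ (C *ᵥ y) ≤ 0)
    (h : IsSwitchedSolution A t₀ t₁ σ x) (hlaw : FollowsSampledMinLaw X η t₀ t₁ σ x)
    {t : ℝ} (ht : t ∈ Icc t₀ t₁) :
    ∃ i, ∀ j, Real.exp (α * (t - t₀)) * quadForm (X i) (x t) + performanceIndex C x t₀ t ≤
      quadForm (X j) (x t₀) := by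
  obtain ⟨τ, hτ, hτ0, hτη, ⟨N, hN⟩, hmode⟩ := hlaw
  have hτge : ∀ k, t₀ ≤ τ k := fun k => hτ0 ▸ hτ.monotone (Nat.zero_le k)
  have hold : ∀ k s, τ k ≤ s → s ≤ τ (k + 1) → s ≤ t₁ →
      Real.exp (α * (s - t₀)) * quadForm (X (σ (τ k))) (x s) + performanceIndex C x t₀ s ≤
      Real.exp (α * (τ k - t₀)) * quadForm (X (σ (τ k))) (x (τ k)) +
        performanceIndex C x t₀ (τ k) := by
    intro k s hks hsk hs
    obtain ⟨hmin, hσ⟩ := hmode k (hks.trans hs)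
    refine h.energy_le_of_eqOn hα (hτge k) hks hs
      (fun r hr => hσ r ⟨hr.1, hr.2.trans_le hsk⟩) fun r hr => hdecay _ _ _ hmin ?_
    refine (h.norm_sub_le_mul_norm hL hA (hτge k) hr.1 (hr.2.trans hs) ?_ hLη).trans (by gcongr)
    linarith [hτη k, hr.2]
  have hsample : ∀ k, τ k ≤ t₁ → ∀ j,
      Real.exp (α * (τ k - t₀)) * quadForm (X (σ (τ k))) (x (τ k)) +
        performanceIndex C x t₀ (τ k) ≤ quadForm (X j) (x t₀) := by
    intro k
    induction k with
    | zero =>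
      intro h0 j
      have := (hmode 0 h0).1 j
      simpa [hτ0, performanceIndex] using this
    | succ k ih =>
      intro hk j
      have hlt : τ k ≤ τ (k + 1) := (hτ k.lt_succ_self).le
      -- At the new sample the held mode is replaced by a minimizer, so the form on the left is no
      -- larger than that of the old mode.
      refine le_trans ?_ ((hold k _ hlt le_rfl hk).trans (ih (hlt.trans hk) j))
      gcongr
      exact (hmode (k + 1) hk).1 _
  have hex : ∃ k, t ≤ τ k := ⟨N, ht.2.trans hN⟩
  -- The predecessor of the first sampling instant not before t starts the holding interval that
  -- contains t; index 0 means t = t₀.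
  have hfind := Nat.find_spec hex
  rcases hk : Nat.find hex with _ | k
  · rw [hk, hτ0] at hfind
    have htt : t = τ 0 := hτ0 ▸ le_antisymm hfind ht.1
    rw [htt]
    exact ⟨_, hsample 0 (htt ▸ ht.2)⟩
  · rw [hk] at hfind
    have hlt : τ k < t := not_le.1 (Nat.find_min hex (hk ▸ k.lt_succ_self))
    exact ⟨_, fun j => (hold k t hlt.le hfind ht.2).trans (hsample k (hlt.le.trans ht.2) j)⟩

end EnergyEstimate

/-- The energy estimate along all trajectories, and along all solutions under sufficiently fast
sample-and-hold implementations of the law. -/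
theorem exists_energy_estimate {n p M : ℕ} (hM : 2 ≤ M)
    (A : Fin M → Matrix (Fin n) (Fin n) ℝ) (C : Matrix (Fin p) (Fin n) ℝ)
    (X : Fin M → Matrix (Fin n) (Fin n) ℝ) (hX : ∀ i, (X i).PosDef) (γ : ℝ) (hγ : 0 < γ)
    (hLM : ∀ i j, j ≠ i →
      (-((A i)ᵀ * X i + X i * A i + γ • (X j - X i) + Cᵀ * C)).PosDef) :
    ∃ α μ η : ℝ, 0 < α ∧ 0 < μ ∧ 0 < η ∧
      (∀ t₀ t₁ σ x h, h ≤ η → IsSwitchedSolution A t₀ t₁ σ x →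
        FollowsSampledMinLaw X h t₀ t₁ σ x → ∀ t ∈ Icc t₀ t₁, ∀ j,
          Real.exp (α * (t - t₀)) * (μ * ‖x t‖ ^ 2) + performanceIndex C x t₀ t ≤
            quadForm (X j) (x t₀)) ∧
      (∀ t₀ t₁ x, IsMinSwitchingTrajectory A X t₀ t₁ x → ∀ t ∈ Icc t₀ t₁, ∀ j,
          Real.exp (α * (t - t₀)) * (μ * ‖x t‖ ^ 2) + performanceIndex C x t₀ t ≤
            quadForm (X j) (x t₀)) := by
  obtain ⟨α, δ, hα, hδ, hdecay⟩ := exists_decay_rate hM A C X hX γ hγ hLM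
  obtain ⟨μ, hμ, hμX⟩ := exists_pos_mul_norm_sq_le_of_family hX
  obtain ⟨L, hL, hA⟩ := exists_norm_mulVec_le_of_family A
  have hη : 0 < min (1 / 2) (δ / 2) / (L + 1) := by positivity
  -- Chosen so that L η ≤ 1/2 and 2 L η ≤ δ; L + 1 guards against L = 0.
  set η := min (1 / 2) (δ / 2) / (L + 1) with hηdef
  have hLη : L * η ≤ min (1 / 2) (δ / 2) := by
    calc L * η ≤ (L + 1) * η := by gcongr; linarith
      _ = _ := by rw [hηdef]; field_simp
  have hsamp : ∀ t₀ t₁ σ x h, h ≤ η → IsSwitchedSolution A t₀ t₁ σ x →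
        FollowsSampledMinLaw X h t₀ t₁ σ x → ∀ t ∈ Icc t₀ t₁, ∀ j,
          Real.exp (α * (t - t₀)) * (μ * ‖x t‖ ^ 2) + performanceIndex C x t₀ t ≤
            quadForm (X j) (x t₀) := by
    intro t₀ t₁ σ x h hh hs hlaw t ht j
    have hLh : L * h ≤ L * η := by gcongr
    obtain ⟨i, hi⟩ := hs.energy_le_of_followsSampledMinLaw hα.le hL hA
      (hLh.trans (hLη.trans (min_le_left _ _)))
      (by linarith [hLη.trans (min_le_right _ _)]) hdecay hlaw ht
    refine le_trans ?_ (hi j)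
    gcongr
    exact hμX i _
  refine ⟨α, μ, η, hα, hμ, hη, hsamp, ?_⟩
  rintro t₀ t₁ x (⟨σ, hs, hlaw⟩ | hlim) t ht j
  · obtain ⟨i, hi⟩ := hs.energy_le_of_followsMinLaw (by omega) hα.le
      (fun i y hy => hdecay i y y hy (by simp; positivity)) hlaw ht
    refine le_trans ?_ (hi j)
    gcongr
    exact hμX i _
  · have hpos : ∀ k : ℕ, 0 < min η (1 / ((k : ℝ) + 1)) := fun k => by positivity
    choose σ y hs hlaw hxy using fun k => hlim _ (hpos k)
    have hest := fun k => hsamp t₀ t₁ _ _ _ (min_le_left _ _) (hs k) (hlaw k)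
    have hconv : ∀ s ∈ Icc t₀ t₁,
        Filter.Tendsto (fun k => y k s) Filter.atTop (nhds (x s)) := by
      intro s hs
      rw [tendsto_iff_norm_sub_tendsto_zero]
      refine squeeze_zero (fun _ => norm_nonneg _) (fun k => ?_)
        tendsto_one_div_add_atTop_nhds_zero_nat
      rw [norm_sub_rev]
      exact (hxy k s hs).trans (min_le_right _ _)
    have h0 : t₀ ∈ Icc t₀ t₁ := ⟨le_rfl, ht.1.trans ht.2⟩
    have hq : Filter.Tendsto (fun k => quadForm (X j) (y k t₀)) Filter.atTop
        (nhds (quadForm (X j) (x t₀))) := ((continuous_quadForm _).tendsto _).comp (hconv _ h0)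
    -- The initial energies converge, hence are bounded. The estimate turns this into a uniform
    -- bound on the approximants, which dominates the cost integrands.
    obtain ⟨B, hB⟩ := hq.bddAbove_range
    obtain ⟨c, hc, hcC⟩ := exists_quadForm_le (Cᵀ * C)
    have hcC' : ∀ z, (C *ᵥ z) ⬝ᵥ (C *ᵥ z) ≤ c * ‖z‖ ^ 2 := fun z => by
      refine le_trans (le_of_eq ?_) (hcC z)
      rw [quadForm, ← Matrix.mulVec_mulVec, Matrix.mulVec_transpose, dotProduct_comm z,
        ← Matrix.dotProduct_mulVec]
    have hbound : ∀ k, ∀ s ∈ Icc t₀ t₁, μ * ‖y k s‖ ^ 2 ≤ B := by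
      intro k s hs
      have h1 : 1 ≤ Real.exp (α * (s - t₀)) :=
        Real.one_le_exp (mul_nonneg hα.le (by linarith [hs.1]))
      have h2 : 0 ≤ performanceIndex C (y k) t₀ s :=
        intervalIntegral.integral_nonneg hs.1 fun _ _ => dotProduct_self_nonneg_real _
      have h3 : μ * ‖y k s‖ ^ 2 ≤ Real.exp (α * (s - t₀)) * (μ * ‖y k s‖ ^ 2) :=
        le_mul_of_one_le_left (by positivity) h1
      linarith [hest k s hs j, hB ⟨k, rfl⟩]
    have hJ : Filter.Tendsto (fun k => performanceIndex C (y k) t₀ t) Filter.atTop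
        (nhds (performanceIndex C x t₀ t)) := by
      have hsub : uIoc t₀ t ⊆ Icc t₀ t₁ := by
        rw [uIoc_of_le ht.1]
        exact fun s hs => ⟨hs.1.le, hs.2.trans ht.2⟩
      refine intervalIntegral.tendsto_integral_filter_of_dominated_convergence
        (fun _ => c * (B / μ)) (Filter.Eventually.of_forall fun k => ?_)
        (Filter.Eventually.of_forall fun k => Filter.Eventually.of_forall fun s hs' => ?_)
        intervalIntegrable_const (Filter.Eventually.of_forall fun s hs' => ?_)
      · exact ((continuous_output_sq.comp_continuousOn
          ((hs k).2.1)).aestronglyMeasurable measurableSet_Icc).mono_set hsub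
      · rw [Real.norm_of_nonneg (dotProduct_self_nonneg_real _)]
        refine (hcC' _).trans ?_
        gcongr
        rw [le_div_iff₀ hμ, mul_comm]
        exact hbound k s (hsub hs')
      · exact (continuous_output_sq.tendsto _).comp (hconv s (hsub hs'))
    exact le_of_tendsto_of_tendsto'
      (((((hconv t ht).norm).pow 2).const_mul μ |>.const_mul _).add hJ) hq
      fun k => hest k t ht j

/-! ### From the energy estimate to exponential stability -/

theorem norm_le_of_exp_mul_norm_sq_le {n : ℕ} {α μ b τ : ℝ} (hμ : 0 < μ) (hb : 0 ≤ b)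
    {x y : Fin n → ℝ} (h : Real.exp (α * τ) * (μ * ‖x‖ ^ 2) ≤ b * ‖y‖ ^ 2) :
    ‖x‖ ≤ Real.sqrt (b / μ) * Real.exp (-(α / 2) * τ) * ‖y‖ := by
  refine le_of_sq_le_sq ?_ (by positivity)
  rw [mul_pow, mul_pow, Real.sq_sqrt (by positivity), ← Real.exp_nat_mul]
  have e : ((2 : ℕ) : ℝ) * (-(α / 2) * τ) = -(α * τ) := by push_cast; ring
  rw [e, Real.exp_neg]
  have := Real.exp_pos (α * τ)
  field_simp
  linarith

theorem globallyExponentiallyStable_of_energy_estimate {n M : ℕ} (hM : 0 < M)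
    (X : Fin M → Matrix (Fin n) (Fin n) ℝ) {α μ : ℝ} (hα : 0 < α) (hμ : 0 < μ)
    {S : ℝ → ℝ → (ℝ → Fin n → ℝ) → Prop}
    (hS : ∀ t₀ t₁ x, S t₀ t₁ x → ∀ t ∈ Icc t₀ t₁, ∀ j,
      Real.exp (α * (t - t₀)) * (μ * ‖x t‖ ^ 2) ≤ quadForm (X j) (x t₀)) :
    GloballyExponentiallyStable S := by
  obtain ⟨b, hb, hbX⟩ := exists_quadForm_le (X ⟨0, hM⟩)
  let e := (PiLp.continuousLinearEquiv 2 ℝ (fun _ : Fin n => ℝ))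
  let f : EuclideanSpace ℝ (Fin n) →L[ℝ] (Fin n → ℝ) := e
  let g : (Fin n → ℝ) →L[ℝ] EuclideanSpace ℝ (Fin n) := e.symm
  -- ‖f‖ and ‖g‖ convert between the sup and Euclidean norms. The rate halves because the energy is
  -- quadratic; the added 1 keeps K positive if the product vanishes.
  refine ⟨‖g‖ * Real.sqrt (b / μ) * ‖f‖ + 1, α / 2, by positivity, by positivity,
    fun t₀ t₁ x hx t ht => ?_⟩
  have h1 := norm_le_of_exp_mul_norm_sq_le hμ hb ((hS t₀ t₁ x hx t ht ⟨0, hM⟩).trans (hbX _))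
  have h2 : ‖WithLp.toLp 2 (x t)‖ ≤ ‖g‖ * ‖x t‖ := g.le_opNorm (x t)
  have h3 : ‖x t₀‖ ≤ ‖f‖ * ‖WithLp.toLp 2 (x t₀)‖ := f.le_opNorm (WithLp.toLp 2 (x t₀))
  calc ‖WithLp.toLp 2 (x t)‖
      ≤ ‖g‖ * (Real.sqrt (b / μ) * Real.exp (-(α / 2) * (t - t₀)) *
        (‖f‖ * ‖WithLp.toLp 2 (x t₀)‖)) := by
        refine h2.trans ?_
        gcongr
        refine h1.trans ?_
        gcongr
    _ = ‖g‖ * Real.sqrt (b / μ) * ‖f‖ * Real.exp (-(α / 2) * (t - t₀)) *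
        ‖WithLp.toLp 2 (x t₀)‖ := by ring
    _ ≤ _ := by
        gcongr
        linarith

/-! ### Construction of sampled solutions -/

theorem exists_isMinMode {n M : ℕ} (hM : 0 < M) (X : Fin M → Matrix (Fin n) (Fin n) ℝ)
    (x : Fin n → ℝ) : ∃ i, IsMinMode X x i :=
  have : Nonempty (Fin M) := ⟨⟨0, hM⟩⟩
  Finite.exists_min fun i => quadForm (X i) x

theorem exists_hasDerivAt_mulVec {n : ℕ} (B : Matrix (Fin n) (Fin n) ℝ) (w : Fin n → ℝ) :
    ∃ φ : ℝ → Fin n → ℝ, φ 0 = w ∧ ∀ t, HasDerivAt φ (B *ᵥ φ t) t := by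
  let b : (Fin n → ℝ) →L[ℝ] (Fin n → ℝ) := (Matrix.mulVecLin B).toContinuousLinearMap
  refine ⟨fun t => NormedSpace.exp (t • b) w, by simp, fun t => ?_⟩
  exact (hasDerivAt_exp_smul_const' b t).clm_apply (hasDerivAt_const t w) |>.congr_deriv
    (by simp [b])

/-- Solutions under periodic sample-and-hold implementations of the law exist. -/
theorem exists_sampled_solution {n M : ℕ} (hM : 0 < M)
    (A X : Fin M → Matrix (Fin n) (Fin n) ℝ) {h : ℝ} (hh : 0 < h) (t₀ : ℝ) (x₀ : Fin n → ℝ) :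
    ∃ (σ : ℝ → Fin M) (y : ℝ → Fin n → ℝ), y t₀ = x₀ ∧ ∀ t₁,
      IsSwitchedSolution A t₀ t₁ σ y ∧ FollowsSampledMinLaw X h t₀ t₁ σ y := by
  choose m hm using exists_isMinMode hM X
  choose φ hφ0 hφ using fun i => exists_hasDerivAt_mulVec (A i)
  -- States at the sampling instants: each arises from the previous one by flowing along its
  -- minimizing mode for time h.
  let w : ℕ → Fin n → ℝ := fun k => Nat.rec x₀ (fun _ v => φ (m v) v h) k
  have hw : ∀ k, w (k + 1) = φ (m (w k)) (w k) h := fun _ => rfl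
  let τ : ℕ → ℝ := fun k => t₀ + k * h
  have hτs : ∀ k, τ (k + 1) = τ k + h := fun k => by simp only [τ]; push_cast; ring
  have hτ : StrictMono τ := strictMono_nat_of_lt_succ fun k => by rw [hτs]; linarith
  have hτ0 : τ 0 = t₀ := by simp [τ]
  -- Index of the holding interval containing t; the natural floor gives 0 before t₀.
  let κ : ℝ → ℕ := fun t => ⌊(t - t₀) / h⌋₊
  let g : ℕ → ℝ → Fin n → ℝ := fun k t => φ (m (w k)) (w k) (t - τ k)
  let σ : ℝ → Fin M := fun t => m (w (κ t))
  let y : ℝ → Fin n → ℝ := fun t => g (κ t) t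
  have hg : ∀ k t, HasDerivAt (g k) (A (m (w k)) *ᵥ g k t) t := fun k t =>
    (hφ (m (w k)) (w k) (t - τ k)).comp_sub_const t (τ k)
  have hκ : ∀ k, ∀ t ∈ Ico (τ k) (τ (k + 1)), κ t = k := by
    intro k t ht
    have h1 := ht.1
    have h2 := ht.2
    rw [hτs] at h2
    simp only [τ] at h1 h2
    have hk : (k : ℝ) ≤ (t - t₀) / h := by
      rw [le_div_iff₀ hh]
      linarith
    refine (Nat.floor_eq_iff ((Nat.cast_nonneg k).trans hk)).2 ⟨hk, ?_⟩
    rw [div_lt_iff₀ hh]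
    linarith
  have hmem : ∀ t, t₀ ≤ t → t ∈ Ico (τ (κ t)) (τ (κ t + 1)) := by
    intro t ht
    have h1 := Nat.floor_le (div_nonneg (sub_nonneg.2 ht) hh.le)
    have h2 := Nat.lt_floor_add_one ((t - t₀) / h)
    rw [le_div_iff₀ hh] at h1
    rw [div_lt_iff₀ hh] at h2
    refine ⟨?_, ?_⟩
    · simp only [τ, κ]
      linarith
    · rw [hτs]
      simp only [τ, κ]
      linarith
  have hκτ : ∀ k, κ (τ k) = k := fun k => hκ k _ ⟨le_rfl, hτ k.lt_succ_self⟩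
  have hyτ : ∀ k, y (τ k) = w k := by
    intro k
    simp only [y, hκτ, g, sub_self]
    exact hφ0 _ _
  have hyg : ∀ k, EqOn y (g k) (Icc (τ k) (τ (k + 1))) := by
    intro k t ht
    rcases ht.2.lt_or_eq with h1 | rfl
    · simp only [y]
      rw [hκ k t ⟨ht.1, h1⟩]
    · rw [hyτ, hw]
      simp only [g]
      rw [hτs, add_sub_cancel_left]
  have hyc : ∀ N, ContinuousOn y (Icc (τ 0) (τ N)) := by
    intro N
    induction N with
    | zero => simp
    | succ N ih =>
      rw [← Icc_union_Icc_eq_Icc (hτ.monotone N.zero_le) (hτ N.lt_succ_self).le]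
      refine ih.union_of_isClosed ?_ isClosed_Icc isClosed_Icc
      exact (ContinuousOn.congr (fun t _ => (hg N t).continuousAt.continuousWithinAt) (hyg N))
  have hex : ∀ t₁, ∃ N, t₁ ≤ τ N := by
    intro t₁
    obtain ⟨N, hN⟩ := exists_nat_ge ((t₁ - t₀) / h)
    rw [div_le_iff₀ hh] at hN
    exact ⟨N, by simp only [τ]; linarith⟩
  have hyc' : ∀ t₁, ContinuousOn y (Icc t₀ t₁) := by
    intro t₁
    obtain ⟨N, hN⟩ := hex t₁
    refine (hyc N).mono ?_
    rw [hτ0]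
    exact Icc_subset_Icc_right hN
  have hσm : Measurable σ := by
    have : Measurable κ :=
      Nat.measurable_floor.comp ((measurable_id.sub_const t₀).div_const h)
    exact (measurable_from_nat (f := fun k => m (w k))).comp this
  -- Left derivatives may differ at sampling instants; with continuity, right derivatives suffice
  -- for the integral equation.
  have hright : ∀ t, t₀ ≤ t → HasDerivWithinAt y (A (σ t) *ᵥ y t) (Ioi t) t := by
    intro t ht
    have hmt := hmem t ht
    refine (hg (κ t) t).hasDerivWithinAt.congr_of_eventuallyEq ?_ rfl
    filter_upwards [Ioo_mem_nhdsGT hmt.2] with s hs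
    exact hyg (κ t) ⟨hmt.1.trans hs.1.le, hs.2.le⟩
  refine ⟨σ, y, ?_, fun t₁ => ⟨⟨hσm, hyc' t₁, fun t ht => ?_⟩, τ, hτ, hτ0,
    fun k => (hτs k).le, hex t₁, fun k _ => ⟨?_, fun t ht => ?_⟩⟩⟩
  · rw [← hτ0]
    exact hyτ 0
  · have hint : IntervalIntegrable (fun s => A (σ s) *ᵥ y s) volume t₀ t :=
      IntegrableOn.intervalIntegrable (by
        rw [uIcc_of_le ht.1]
        exact integrableOn_mulVec_of_continuousOn hσm (hyc' t))
    rw [intervalIntegral.integral_eq_sub_of_hasDeriv_right_of_le ht.1 (hyc' t)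
      (fun s hs => hright s hs.1.le) hint]
    abel
  · rw [hyτ]
    simp only [σ, hκτ]
    exact hm _
  · simp only [σ, hκτ, hκ k t ht]

/-! ### Compactness and existence of trajectories -/

/-- **Arzelà–Ascoli** for uniformly bounded, uniformly Lipschitz functions on the line. -/
theorem exists_tendstoUniformlyOn_of_lipschitz {n : ℕ} {ι : Type*} (u : Ultrafilter ι)
    {Y : ι → ℝ → Fin n → ℝ} {K : NNReal} {R : ℝ} (hY : ∀ i, LipschitzWith K (Y i))
    (hR : ∀ i t, ‖Y i t‖ ≤ R) :
    ∃ x : ℝ → Fin n → ℝ, ∀ S : Set ℝ, IsCompact S →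
      TendstoUniformlyOn Y x (u : Filter ι) S := by
  let T : Set C(ℝ, Fin n → ℝ) := {f | LipschitzWith K f ∧ ∀ t, ‖f t‖ ≤ R}
  -- For pointwise convergence this image is a closed part of a product of closed balls, hence
  -- compact; equicontinuity lifts this to the compact-open topology.
  have himage : ContinuousMap.toFun '' T =
      {f : ℝ → Fin n → ℝ | LipschitzWith K f} ∩
        univ.pi fun _ => Metric.closedBall (0 : Fin n → ℝ) R := by
    ext f
    constructor
    · rintro ⟨f, hf, rfl⟩
      exact ⟨hf.1, fun t _ => by simpa using hf.2 t⟩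
    · rintro ⟨h1, h2⟩
      exact ⟨⟨f, h1.continuous⟩, ⟨h1, fun t => by simpa using h2 t trivial⟩, rfl⟩
  have hclosed : IsClosed {f : ℝ → Fin n → ℝ | LipschitzWith K f} := by
    simp only [lipschitzWith_iff_dist_le_mul, ofPred_forall]
    exact isClosed_iInter fun a => isClosed_iInter fun b =>
      isClosed_le ((continuous_apply a).dist (continuous_apply b)) continuous_const
  have hT : IsCompact T := by
    refine ArzelaAscoli.isCompact_of_equicontinuous T ?_ ?_
    · rw [himage]
      exact (isCompact_univ_pi fun _ => isCompact_closedBall _ _).inter_left hclosed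
    · exact (LipschitzWith.uniformEquicontinuous _ K fun f => f.2.1).equicontinuous
  let F : ι → C(ℝ, Fin n → ℝ) := fun i => ⟨Y i, (hY i).continuous⟩
  obtain ⟨f, -, hf⟩ := hT.ultrafilter_le_nhds (u.map F) (by
    rw [Filter.le_principal_iff]
    exact Filter.mem_map.2 (Filter.univ_mem' fun i => ⟨hY i, hR i⟩))
  have := ContinuousMap.tendsto_iff_forall_isCompact_tendstoUniformlyOn.1
    (show Filter.Tendsto F (u : Filter ι) (nhds f) from hf)
  exact ⟨f, this⟩

/-- Since R does not depend on t₁, the Lipschitz constant L R holds on the whole half-line, and a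
single limit serves every t₁. -/
theorem exists_minSwitchingTrajectory {n M : ℕ} (hM : 0 < M)
    (A X : Fin M → Matrix (Fin n) (Fin n) ℝ) (t₀ : ℝ) (x₀ : Fin n → ℝ) {η R : ℝ} (hη : 0 < η)
    (hR : ∀ t₁ σ y h, h ≤ η → y t₀ = x₀ → IsSwitchedSolution A t₀ t₁ σ y →
      FollowsSampledMinLaw X h t₀ t₁ σ y → ∀ t ∈ Icc t₀ t₁, ‖y t‖ ≤ R) :
    ∃ x : ℝ → Fin n → ℝ, x t₀ = x₀ ∧ ∀ t₁, IsMinSwitchingTrajectory A X t₀ t₁ x := by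
  obtain ⟨L, hL, hA⟩ := exists_norm_mulVec_le_of_family A
  have hpos : ∀ k : ℕ, 0 < min η (1 / ((k : ℝ) + 1)) := fun k => by positivity
  choose σ y hy0 hs using fun k => exists_sampled_solution hM A X (hpos k) t₀ x₀
  have hyR : ∀ k t, t₀ ≤ t → ‖y k t‖ ≤ R := fun k t ht =>
    hR t _ _ _ (min_le_left _ _) (hy0 k) (hs k t).1 (hs k t).2 t ⟨ht, le_rfl⟩
  have hR0 : 0 ≤ R := (norm_nonneg _).trans (hyR 0 t₀ le_rfl)
  -- Replacing t by max t₀ t extends each approximant constantly to the left of t₀, so the bounds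
  -- hold on all of ℝ.
  have hlip : ∀ k, LipschitzWith (L * R).toNNReal fun t => y k (max t₀ t) := by
    intro k
    refine LipschitzWith.of_dist_le_mul fun a b => ?_
    rw [Real.coe_toNNReal _ (by positivity), dist_eq_norm, Real.dist_eq]
    refine ((hs k (max (max t₀ a) (max t₀ b))).1.lipschitz hL hA (fun t ht => hyR k t ht.1)
      _ ⟨le_max_left _ _, le_max_left _ _⟩ _ ⟨le_max_left _ _, le_max_right _ _⟩).trans ?_
    refine mul_le_mul_of_nonneg_left ?_ (by positivity)
    simpa using abs_max_sub_max_le_max t₀ a t₀ b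
  obtain ⟨x, hx⟩ := exists_tendstoUniformlyOn_of_lipschitz (Filter.hyperfilter ℕ) hlip
    fun k t => hyR k _ (le_max_left _ _)
  refine ⟨x, ?_, fun t₁ => Or.inr fun ε hε => ?_⟩
  · have := (hx {t₀} isCompact_singleton).tendsto_at (mem_singleton t₀)
    simp only [max_self, hy0] at this
    exact tendsto_nhds_unique this tendsto_const_nhds
  · have h1 := Metric.tendstoUniformlyOn_iff.1 (hx (Icc t₀ t₁) isCompact_Icc) ε hε
    have h2 : ∀ᶠ k : ℕ in (Filter.hyperfilter ℕ : Filter ℕ), 1 / ((k : ℝ) + 1) < ε :=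
      (tendsto_one_div_add_atTop_nhds_zero_nat.mono_left
        (Nat.hyperfilter_le_atTop)).eventually_lt_const hε
    obtain ⟨k, hk1, hk2⟩ := (h1.and h2).exists
    obtain ⟨τ, hτ, hτ0, hτh, hτN, hmode⟩ := (hs k t₁).2
    refine ⟨σ k, y k, (hs k t₁).1, ⟨τ, hτ, hτ0, fun j => (hτh j).trans ?_, hτN, hmode⟩,
      fun t ht => ?_⟩
    · linarith [min_le_right η (1 / ((k : ℝ) + 1))]
    · have := hk1 t ht
      rw [max_eq_right ht.1, dist_eq_norm] at this
      exact this.le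

/-! ### The main theorem -/

theorem theorem3 {n p M : ℕ} (hM : 2 ≤ M)
    (A : Fin M → Matrix (Fin n) (Fin n) ℝ) (C : Matrix (Fin p) (Fin n) ℝ)
    (X : Fin M → Matrix (Fin n) (Fin n) ℝ) (hX : ∀ i, (X i).PosDef)
    (γ : ℝ) (hγ : 0 < γ)
    (hLM : ∀ i j, j ≠ i →
      (-((A i)ᵀ * X i + X i * A i + γ • (X j - X i) + Cᵀ * C)).PosDef) :
    -- trajectories of the closed loop exist for all initial data and all future times
    (∀ (t₀ : ℝ) (x₀ : Fin n → ℝ), ∃ x : ℝ → Fin n → ℝ, x t₀ = x₀ ∧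
      ∀ t₁, t₀ ≤ t₁ → IsMinSwitchingTrajectory A X t₀ t₁ x) ∧
    -- the origin is globally exponentially stable
    GloballyExponentiallyStable (IsMinSwitchingTrajectory A X) ∧
    -- guaranteed cost
    (∀ (t₀ t₁ : ℝ) (x : ℝ → Fin n → ℝ), IsMinSwitchingTrajectory A X t₀ t₁ x →
      ∀ t ∈ Icc t₀ t₁, performanceIndex C x t₀ t ≤ ∑ i, quadForm (X i) (x t₀)) := by
  obtain ⟨α, μ, η, hα, hμ, hη, hsamp, htraj⟩ := exists_energy_estimate hM A C X hX γ hγ hLM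
  have hM0 : 0 < M := by omega
  have hJ : ∀ (x : ℝ → Fin n → ℝ) {t₀ t : ℝ}, t₀ ≤ t → 0 ≤ performanceIndex C x t₀ t :=
    fun x t₀ t ht => intervalIntegral.integral_nonneg ht fun _ _ => dotProduct_self_nonneg_real _
  refine ⟨fun t₀ x₀ => ?_, ?_, fun t₀ t₁ x hx t ht => ?_⟩
  · obtain ⟨b, hb, hbX⟩ := exists_quadForm_le (X ⟨0, hM0⟩)
    obtain ⟨x, hx0, hx⟩ := exists_minSwitchingTrajectory hM0 A X t₀ x₀
      (R := Real.sqrt (b / μ) * ‖x₀‖) hη (by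
        rintro t₁ σ y h hh rfl hs hlaw t ht
        have h1 := hsamp t₀ t₁ σ y h hh hs hlaw t ht ⟨0, hM0⟩
        refine (norm_le_of_exp_mul_norm_sq_le (α := α) hμ hb
          (by linarith [hJ y ht.1, hbX (y t₀)] :
            Real.exp (α * (t - t₀)) * (μ * ‖y t‖ ^ 2) ≤ b * ‖y t₀‖ ^ 2)).trans ?_
        gcongr
        refine mul_le_of_le_one_right (Real.sqrt_nonneg _) (Real.exp_le_one_iff.2 ?_)
        exact mul_nonpos_of_nonpos_of_nonneg (by linarith) (sub_nonneg.2 ht.1))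
    exact ⟨x, hx0, fun t₁ _ => hx t₁⟩
  · refine globallyExponentiallyStable_of_energy_estimate hM0 X hα hμ fun t₀ t₁ x hx t ht j => ?_
    linarith [htraj t₀ t₁ x hx t ht j, hJ x ht.1]
  · have h1 := htraj t₀ t₁ x hx t ht ⟨0, hM0⟩
    have h2 : 0 ≤ Real.exp (α * (t - t₀)) * (μ * ‖x t‖ ^ 2) := by positivity
    have h3 := Finset.single_le_sum (f := fun i => quadForm (X i) (x t₀))
      (fun i _ => (hX i).quadForm_nonneg _) (Finset.mem_univ (⟨0, hM0⟩ : Fin M))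
    linarith
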